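/- Let $\mathbb{R}^2$ carry the usual scalar product $(\cdot,\cdot)$ and norm $|\cdot|$. The Gaussian algorithm takes as input an ordered basis $(b_1,b_2)$ of a two-dimensional lattice in $\mathbb{R}^2$ and proceeds as follows: replace $b_2$ by $b_2-xb_1$, where $x=\lfloor m+1/2\rfloor$ is the integer nearest to $m=(b_2,b_1)/(b_1,b_1)$; if now $|b_1|>|b_2|$, swap $b_1$ and $b_2$ and start again; otherwise stop and output $(b_1,b_2)$. A step is an integer translation followed by a swap, so the number of steps is the number of swaps made. The length of the input is $\max(|b_1|,|b_2|)$. There is an absolute constant $A>0$ such that, for every real $M$: (i) on every input $(b_1,b_2)$ with integer coordinates and of length less than $M$, the Gaussian algorithm terminates after at most $\log_{1+\sqrt2}(M/A)$ steps; (ii) more generally, on every real input $(b_1,b_2)$ of length less than $M$, the Gaussian algorithm terminates after at most $\log_{1+\sqrt2}\bigl(M/(A\lambda)\bigr)$ steps, where $\lambda>0$ is any lower bound for the norms of the nonzero vectors of the lattice $\mathbb{Z}b_1+\mathbb{Z}b_2$ (for instance the norm of a shortest nonzero vector). -/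

import Mathlib

/-- The Euclidean plane. -/
abbrev Plane : Type := EuclideanSpace ℝ (Fin 2)

namespace GaussianAlgorithm

/-- The length of an ordered basis `(b 0, b 1)`: the larger of the Euclidean norms of its vectors. -/
noncomputable def length (b : Fin 2 → Plane) : ℝ := max ‖b 0‖ ‖b 1‖

/-- Integer translation of `b 1` in the direction of `b 0`: `b 1` is replaced by `b 1 - x • b 0`,
where `x` is the integer nearest to `m = (b 1, b 0) / (b 0, b 0)`. Ties are rounded up, so that the
new value of `m` satisfies `-1/2 ≤ m < 1/2`, that is, the new basis is proper. -/
noncomputable def translate (b : Fin 2 → Plane) : Fin 2 → Plane :=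
  ![b 0, b 1 - round (inner ℝ (b 1) (b 0) / inner ℝ (b 0) (b 0)) • b 0]

/-- Exchange of the two vectors. -/
def swap (b : Fin 2 → Plane) : Fin 2 → Plane := ![b 1, b 0]

/-- `Run b k r`: on the input `(b 0, b 1)` the Gaussian algorithm terminates with the output `r`
after exactly `k` steps, a step being an integer translation followed by a swap. The swap is made
if after the translation the first vector is strictly longer than the second one; otherwise the
algorithm terminates and outputs the translated basis. -/
inductive Run : (Fin 2 → Plane) → ℕ → (Fin 2 → Plane) → Prop
  | halt (b : Fin 2 → Plane) (h : ‖translate b 0‖ ≤ ‖translate b 1‖) : Run b 0 (translate b)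
  | step (b : Fin 2 → Plane) (k : ℕ) (r : Fin 2 → Plane)
      (h : ‖translate b 1‖ < ‖translate b 0‖) (hr : Run (swap (translate b)) k r) :
      Run b (k + 1) r

/-- The algorithm is deterministic: the number of steps and the output depend only on the input. -/
theorem Run.unique {b r r' : Fin 2 → Plane} {k k' : ℕ} (h : Run b k r) (h' : Run b k' r') :
    k = k' ∧ r = r' := by
  induction h generalizing k' r' with
  | halt b hb =>
    cases h' with
    | halt _ _ => exact ⟨rfl, rfl⟩
    | step _ _ _ hb' _ => exact absurd hb (not_le.mpr hb')
  | step b k r hb _ ih =>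
    cases h' with
    | halt _ hb' => exact absurd hb' (not_le.mpr hb)
    | step _ _ _ _ hr' =>
      obtain ⟨h1, h2⟩ := ih hr'
      exact ⟨by rw [h1], h2⟩

end GaussianAlgorithm

namespace GaussianAlgorithm

/-! ### Growth of centred continuants -/

/-! The successive first vectors satisfy `u n = x n • u (n+1) + u (n+2)`, a centred Euclidean
division. While norms decrease, properness forces `|x n| ≥ 2`, and a quotient `±2` is followed by
one of the same sign (`two_le_abs_quotient` and the two `round_` lemmas). Pairing the recurrence
with a late vector `w` turns it into a scalar one, whose solutions grow by a factor `1 + √2` per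
step (`continuant_growth`), the rate for constant quotient 2. Cauchy–Schwarz turns this into a bound
on `‖w‖`, and `‖w‖ ≥ l` bounds the number of steps. -/

theorem one_lt_one_add_sqrt_two : (1 : ℝ) < 1 + √2 := by
  have : 0 < √2 := by positivity
  linarith

/-- If `a = x b + c` with `2 ≤ |x|`, then `|a|` is large, unless `x = ±2` and the signs of `x b`
and `c` are opposite. -/
theorem abs_lower_bound {a b c : ℝ} {x : ℤ} (h : a = x * b + c) (hx : 2 ≤ |x|)
    (h2 : x = 2 → 0 ≤ b * c) (h2' : x = -2 → b * c ≤ 0) :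
    2 * |b| + |c| ≤ |a| ∨ 3 * |b| - |c| ≤ |a| := by
  rcases hx.eq_or_lt with hx | hx
  · left
    rcases (abs_eq (by norm_num)).1 hx.symm with rfl | rfl
    · have h3 : |2 * b + c| = |2 * b| + |c| := by
        rw [abs_add_eq_add_abs_iff]
        rcases mul_nonneg_iff.1 (h2 rfl) with h | h
        · exact Or.inl ⟨by linarith, h.2⟩
        · exact Or.inr ⟨by linarith, h.2⟩
      rw [h]
      push_cast
      rw [h3, abs_mul, abs_two]
    · have h3 : |(-2) * b + c| = |(-2) * b| + |c| := by
        rw [abs_add_eq_add_abs_iff]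
        rcases mul_nonpos_iff.1 (h2' rfl) with h | h
        · exact Or.inr ⟨by linarith, h.2⟩
        · exact Or.inl ⟨by linarith, h.2⟩
      rw [h]
      push_cast
      rw [h3, abs_mul, abs_neg, abs_two]
  · right
    have h3 : (3 : ℝ) ≤ |(x : ℝ)| := by exact_mod_cast hx
    have h4 : |(x : ℝ) * b| ≤ |a| + |c| := by
      have := abs_sub a c
      rwa [h, add_sub_cancel_right, ← h] at this
    rw [abs_mul] at h4
    nlinarith [abs_nonneg b]

/-- If `a = x b + c` with `2 ≤ |x|` and `c` is not too large, then `a` has the sign of `x b`. -/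
theorem mul_mul_nonneg {a b c : ℝ} {x : ℤ} (h : a = x * b + c) (hx : 2 ≤ |x|)
    (hc : |c| ≤ |b|) : 0 ≤ x * (a * b) := by
  have hx' : (2 : ℝ) ≤ |(x : ℝ)| := by exact_mod_cast hx
  have h1 : x * (a * b) = (|(x : ℝ)| * |b|) ^ 2 + x * b * c := by
    rw [mul_pow, sq_abs, sq_abs, h]
    ring
  have h2 : |x * b * c| ≤ |(x : ℝ)| * |b| * |b| := by
    rw [abs_mul, abs_mul]
    gcongr
  have h3 : |(x : ℝ)| * |b| * |b| ≤ (|(x : ℝ)| * |b|) ^ 2 := by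
    have : 0 ≤ |(x : ℝ)| * |b| * |b| * (|(x : ℝ)| - 1) := by
      apply mul_nonneg (by positivity)
      linarith
    nlinarith
  linarith [neg_abs_le (x * b * c)]

/-- Since `b * c` has the sign of the next quotient `y`, the rule on consecutive quotients excludes
cancellation in `x * b + c` when `x = ±2`. -/
theorem sign_rule {b c : ℝ} {x y : ℤ} (h : 0 ≤ y * (b * c)) (h2 : x = 2 → 2 ≤ y)
    (h2' : x = -2 → y ≤ -2) : (x = 2 → 0 ≤ b * c) ∧ (x = -2 → b * c ≤ 0) := by
  constructor
  · intro hx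
    have hy : (2 : ℝ) ≤ y := by exact_mod_cast h2 hx
    exact nonneg_of_mul_nonneg_right h (by linarith)
  · intro hx
    have hy : (y : ℝ) ≤ -2 := by exact_mod_cast h2' hx
    by_contra! hbc
    nlinarith

/-- The potential `|a 0| + (√2 - 1) * |a 1|` is an eigenform, with eigenvalue `1 + √2`, of the
extremal recurrence with quotient 2. The first two conclusions keep the induction going. -/
theorem continuant_growth (k : ℕ) : ∀ (a : ℕ → ℝ) (x : ℕ → ℤ),
    (∀ n ≤ k + 1, a n = x n * a (n + 1) + a (n + 2)) → (∀ n ≤ k + 1, 2 ≤ |x n|) →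
    (∀ n ≤ k, x n = 2 → 2 ≤ x (n + 1)) → (∀ n ≤ k, x n = -2 → x (n + 1) ≤ -2) →
    2 * |a (k + 3)| ≤ |a (k + 2)| →
    2 * |a 1| ≤ |a 0| ∧ 0 ≤ x 0 * (a 0 * a 1) ∧
      (1 + √2) ^ k * |a (k + 2)| ≤ |a 0| + (√2 - 1) * |a 1| := by
  have hs : √2 ^ 2 = 2 := Real.sq_sqrt (by norm_num)
  have hs1 : 1 ≤ √2 := Real.one_le_sqrt.2 (by norm_num)
  induction k with
  | zero =>
    intro a x ha hx h2 h2' h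
    -- The ratio is only 3/2 here, as nothing controls the sign of `a 3` when `x 1 = ±2`.
    have h1 : 3 * |a 2| ≤ 2 * |a 1| := by
      have hx1 : (2 : ℝ) ≤ |(x 1 : ℝ)| := by exact_mod_cast hx 1 le_rfl
      have h3 : |(x 1 : ℝ) * a 2| ≤ |a 1| + |a 3| := by
        have := abs_sub (a 1) (a 3)
        rwa [ha 1 le_rfl, add_sub_cancel_right, ← ha 1 le_rfl] at this
      rw [abs_mul] at h3
      norm_num at h
      nlinarith [abs_nonneg (a 2)]
    have hs1' := mul_mul_nonneg (ha 1 le_rfl) (hx 1 le_rfl)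
      (by norm_num at h ⊢; linarith [abs_nonneg (a 3)])
    have hr := sign_rule hs1' (h2 0 le_rfl) (h2' 0 le_rfl)
    have hc : |a 2| ≤ |a 1| := by linarith [abs_nonneg (a 2)]
    have hb : 2 * |a 1| ≤ |a 0| := by
      rcases abs_lower_bound (ha 0 (by omega)) (hx 0 (by omega)) hr.1 hr.2 with h' | h' <;>
        norm_num at h' <;> linarith [abs_nonneg (a 2)]
    refine ⟨hb, mul_mul_nonneg (ha 0 (by omega)) (hx 0 (by omega)) hc, ?_⟩
    norm_num
    nlinarith [abs_nonneg (a 1)]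
  | succ k ih =>
    intro a x ha hx h2 h2' h
    obtain ⟨i1, i2, i3⟩ := ih (fun n => a (n + 1)) (fun n => x (n + 1))
      (fun n hn => ha (n + 1) (by omega)) (fun n hn => hx (n + 1) (by omega))
      (fun n hn => h2 (n + 1) (by omega)) (fun n hn => h2' (n + 1) (by omega)) h
    norm_num at i1 i2 i3
    have hr := sign_rule i2 (h2 0 (by omega)) (h2' 0 (by omega))
    have hc : |a 2| ≤ |a 1| := by linarith [abs_nonneg (a 2)]
    have hb := abs_lower_bound (ha 0 (by omega)) (hx 0 (by omega)) hr.1 hr.2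
    norm_num at hb
    refine ⟨?_, mul_mul_nonneg (ha 0 (by omega)) (hx 0 (by omega)) hc, ?_⟩
    · rcases hb with h' | h' <;> linarith [abs_nonneg (a 2)]
    · have h5 : (1 + √2) ^ (k + 1) * |a (k + 1 + 2)| ≤
          (1 + √2) * (|a 1| + (√2 - 1) * |a 2|) := by
        rw [pow_succ', mul_assoc]
        exact mul_le_mul_of_nonneg_left i3 (by positivity)
      have h6 : (1 + √2) * (|a 1| + (√2 - 1) * |a 2|) = (1 + √2) * |a 1| + |a 2| := by
        linear_combination |a 2| * hs
      -- The case `3|a 1| - |a 2| ≤ |a 0|` needs exactly `2|a 2| ≤ |a 1|`, which is `i1`.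
      rcases hb with h' | h' <;> linarith

/-! ### Sequences of vectors obtained by centred division -/

section

variable {E : Type*} [NormedAddCommGroup E] [InnerProductSpace ℝ E]

/-- `p` is short in the direction of `u`. -/
def Proper (u p : E) : Prop := 2 * |inner ℝ p u| ≤ ‖u‖ ^ 2

theorem proper_sub_round_smul (u v : E) :
    Proper u (v - round (inner ℝ v u / inner ℝ u u) • u) := by
  rcases eq_or_ne u 0 with rfl | hu
  · simp [Proper]
  have hpos : 0 < ‖u‖ ^ 2 := by positivity
  have h := abs_sub_round (inner ℝ v u / ‖u‖ ^ 2)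
  rw [Proper, real_inner_self_eq_norm_sq, ← Int.cast_smul_eq_zsmul ℝ, inner_sub_left,
    real_inner_smul_left, real_inner_self_eq_norm_sq]
  have h2 : inner ℝ v u - (round (inner ℝ v u / ‖u‖ ^ 2) : ℝ) * ‖u‖ ^ 2 =
      (inner ℝ v u / ‖u‖ ^ 2 - round (inner ℝ v u / ‖u‖ ^ 2)) * ‖u‖ ^ 2 := by
    field_simp
  rw [h2, abs_mul, abs_of_pos hpos]
  nlinarith

theorem norm_sq_combination (x : ℝ) (p q : E) :
    ‖x • p + q‖ ^ 2 = x ^ 2 * ‖p‖ ^ 2 + 2 * x * inner ℝ p q + ‖q‖ ^ 2 := by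
  rw [norm_add_sq_real, norm_smul, mul_pow, Real.norm_eq_abs, sq_abs, real_inner_smul_left]
  ring

theorem inner_combination (x : ℝ) (p q : E) :
    inner ℝ p (x • p + q) = x * ‖p‖ ^ 2 + inner ℝ p q := by
  rw [inner_add_right, real_inner_smul_right, real_inner_self_eq_norm_sq]

/-- For `x = ±1`, expanding properness gives `‖p‖ ≤ ‖q‖`; for `x = 0`, `u = q`. -/
theorem two_le_abs_quotient {u p q : E} {x : ℤ} (h : u = (x : ℝ) • p + q) (hu : Proper u p)
    (hq : ‖q‖ < ‖p‖) (hp : ‖p‖ < ‖u‖) : 2 ≤ |x| := by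
  have hq2 : ‖q‖ ^ 2 < ‖p‖ ^ 2 := by gcongr
  by_contra! hx
  rw [Proper, h, norm_sq_combination, inner_combination] at hu
  have h1 := le_abs_self ((x : ℝ) * ‖p‖ ^ 2 + inner ℝ p q)
  have h2 := neg_le_abs ((x : ℝ) * ‖p‖ ^ 2 + inner ℝ p q)
  obtain ⟨h3, h4⟩ := abs_lt.1 hx
  obtain rfl | rfl | rfl : x = 0 ∨ x = 1 ∨ x = -1 := by omega
  · simp only [Int.cast_zero, zero_smul, zero_add] at h
    rw [h] at hp
    linarith
  · push_cast at *
    linarith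
  · push_cast at *
    linarith

/-- Properness expands to `-2 (p, q) ≤ ‖q‖ ^ 2`. With `2 ≤ |x|` for the next quotient, this makes it
at least 2. -/
theorem round_nonneg_of_quotient_eq_two {u p q : E} (h : u = (2 : ℝ) • p + q)
    (hu : Proper u p) : 0 ≤ round (inner ℝ p q / inner ℝ q q) := by
  rw [Proper, h, norm_sq_combination, inner_combination] at hu
  have h1 := le_abs_self (2 * ‖p‖ ^ 2 + inner ℝ p q)
  rw [round_eq, Int.floor_nonneg, real_inner_self_eq_norm_sq]
  rcases eq_or_ne q 0 with rfl | hq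
  · simp
  have hpos : 0 < ‖q‖ ^ 2 := by positivity
  have : -(1 / 2) ≤ inner ℝ p q / ‖q‖ ^ 2 := by
    rw [le_div_iff₀ hpos]
    linarith
  linarith

/-- The bound is 1, not 0, because ties round up; `2 ≤ |x|` still leaves only `x ≤ -2`. -/
theorem round_le_one_of_quotient_eq_neg_two {u p q : E} (h : u = (-2 : ℝ) • p + q)
    (hu : Proper u p) : round (inner ℝ p q / inner ℝ q q) ≤ 1 := by
  rw [Proper, h, norm_sq_combination, inner_combination] at hu
  have h1 := neg_le_abs (-2 * ‖p‖ ^ 2 + inner ℝ p q)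
  rw [round_eq, ← Int.lt_add_one_iff, Int.floor_lt, real_inner_self_eq_norm_sq]
  rcases eq_or_ne q 0 with rfl | hq
  · norm_num
  have hpos : 0 < ‖q‖ ^ 2 := by positivity
  have : inner ℝ p q / ‖q‖ ^ 2 ≤ 1 / 2 := by
    rw [div_le_iff₀ hpos]
    linarith
  push_cast
  linarith

theorem norm_growth (k : ℕ) (u : ℕ → E) (h0 : Proper (u 0) (u 1))
    (hu : ∀ n, u (n + 2) =
      u n - round (inner ℝ (u n) (u (n + 1)) / inner ℝ (u (n + 1)) (u (n + 1))) • u (n + 1))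
    (hdec : ∀ n < k + 3, ‖u (n + 1)‖ < ‖u n‖) :
    (1 + √2) ^ k * ‖u (k + 2)‖ ≤ 2 * ‖u 0‖ := by
  set x : ℕ → ℤ := fun n =>
    round (inner ℝ (u n) (u (n + 1)) / inner ℝ (u (n + 1)) (u (n + 1))) with hx
  have hrec : ∀ n, u n = (x n : ℝ) • u (n + 1) + u (n + 2) := by
    intro n
    rw [hu n, Int.cast_smul_eq_zsmul]
    simp [hx]
  have hproper : ∀ n, Proper (u n) (u (n + 1)) := by
    intro n
    cases n with
    | zero => exact h0
    | succ n =>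
      rw [hu n]
      exact proper_sub_round_smul _ _
  have hx2 : ∀ n ≤ k + 1, 2 ≤ |x n| := fun n hn =>
    two_le_abs_quotient (hrec n) (hproper n) (hdec (n + 1) (by omega)) (hdec n (by omega))
  set w := u (k + 2) with hw
  have hwpos : 0 < ‖w‖ := (norm_nonneg _).trans_lt (hdec (k + 2) (by omega))
  have key := continuant_growth k (fun n => inner ℝ (u n) w) x
    (fun n _ => by
      conv_lhs => rw [hrec n]
      rw [inner_add_left, real_inner_smul_left])
    hx2
    (fun n hn h => by
      have h1 : 0 ≤ x (n + 1) := by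
        refine round_nonneg_of_quotient_eq_two (u := u n) ?_ (hproper n)
        rw [hrec n, h]
        norm_num
      have h2 := hx2 (n + 1) (by omega)
      rwa [abs_of_nonneg h1] at h2)
    (fun n hn h => by
      have h1 : x (n + 1) ≤ 1 := by
        refine round_le_one_of_quotient_eq_neg_two (u := u n) ?_ (hproper n)
        rw [hrec n, h]
        norm_num
      have h2 := hx2 (n + 1) (by omega)
      rw [le_abs] at h2
      omega)
    -- Properness of the pair `w`, `u (k+3)` starts the growth at its far end.
    (by
      have := hproper (k + 2)
      rw [Proper] at this
      simp only [← hw, real_inner_self_eq_norm_sq]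
      rwa [abs_of_nonneg (sq_nonneg ‖w‖)])
  obtain ⟨k1, -, k3⟩ := key
  rw [← hw, real_inner_self_eq_norm_sq, abs_of_nonneg (sq_nonneg _)] at k3
  have hs : √2 ≤ 2 := Real.sqrt_le_iff.2 (by norm_num)
  have hcs := abs_real_inner_le_norm (u 0) w
  have h4 : (√2 - 1) * |inner ℝ (u 1) w| ≤ |inner ℝ (u 0) w| := by
    nlinarith [abs_nonneg (inner ℝ (u 1) w)]
  refine le_of_mul_le_mul_right ?_ hwpos
  linarith

end

/-! ### Iterates of the algorithm -/

/-- The basis after one step, the termination test being ignored. -/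
noncomputable def next (b : Fin 2 → Plane) : Fin 2 → Plane := swap (translate b)

@[simp] theorem translate_zero (b : Fin 2 → Plane) : translate b 0 = b 0 := rfl

@[simp] theorem translate_one (b : Fin 2 → Plane) : translate b 1 =
    b 1 - round (inner ℝ (b 1) (b 0) / inner ℝ (b 0) (b 0)) • b 0 := rfl

@[simp] theorem next_zero (b : Fin 2 → Plane) : next b 0 = translate b 1 := rfl

@[simp] theorem next_one (b : Fin 2 → Plane) : next b 1 = b 0 := rfl

theorem linearIndependent_next {b : Fin 2 → Plane} (h : LinearIndependent ℝ b) :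
    LinearIndependent ℝ (next b) := by
  have h' : LinearIndependent ℝ ![b 0, b 1] := by
    convert h using 1
    ext i : 1
    fin_cases i <;> rfl
  have : next b = ![translate b 1, b 0] := rfl
  rw [this, LinearIndependent.pair_iff]
  rw [LinearIndependent.pair_iff] at h'
  intro s t hst
  rw [translate_one, ← Int.cast_smul_eq_zsmul ℝ] at hst
  set x : ℝ := (round (inner ℝ (b 1) (b 0) / inner ℝ (b 0) (b 0)) : ℝ)
  obtain ⟨h1, h2⟩ := h' (t - s * x) s (by
    rw [← hst]
    module)
  subst h2
  exact ⟨rfl, by linarith⟩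

theorem linearIndependent_iterate_next {b : Fin 2 → Plane} (h : LinearIndependent ℝ b) (n : ℕ) :
    LinearIndependent ℝ (next^[n] b) := by
  induction n with
  | zero => exact h
  | succ n ih =>
    rw [Function.iterate_succ_apply']
    exact linearIndependent_next ih

theorem iterate_next_mem_span (b : Fin 2 → Plane) (n : ℕ) :
    ∀ i, next^[n] b i ∈ Submodule.span ℤ (Set.range b) := by
  induction n with
  | zero => exact fun i => Submodule.subset_span ⟨i, rfl⟩
  | succ n ih =>
    rw [Function.iterate_succ_apply', Fin.forall_fin_two]
    refine ⟨?_, ih 0⟩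
    rw [next_zero, translate_one]
    exact sub_mem (ih 1) (Submodule.smul_mem _ _ (ih 0))

theorem exists_run (n : ℕ) : ∀ b : Fin 2 → Plane,
    (∀ m < n, ‖next^[m + 1] b 0‖ < ‖next^[m] b 0‖) →
    ‖next^[n] b 0‖ ≤ ‖next^[n + 1] b 0‖ → ∃ r, Run b n r := by
  induction n with
  | zero => exact fun b _ h => ⟨_, Run.halt b h⟩
  | succ n ih =>
    intro b h1 h2
    obtain ⟨r, hr⟩ := ih (next b) (fun m hm => h1 (m + 1) (by omega)) h2
    exact ⟨r, Run.step b n r (h1 0 (by omega)) hr⟩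

theorem pow_mul_le_of_steps {b : Fin 2 → Plane} {l : ℝ} (hb : LinearIndependent ℝ b) (hl : 0 < l)
    (hmin : ∀ v ∈ Submodule.span ℤ (Set.range b), v ≠ 0 → l ≤ ‖v‖) (n : ℕ)
    (hn : ∀ m < n, ‖next^[m + 1] b 0‖ < ‖next^[m] b 0‖) :
    (1 + √2) ^ n * l ≤ 2 * (1 + √2) ^ 3 * length b := by
  have hmin' : ∀ m, l ≤ ‖next^[m] b 0‖ := fun m =>
    hmin _ (iterate_next_mem_span b m 0) ((linearIndependent_iterate_next hb m).ne_zero 0)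
  have hlen : ‖b 0‖ ≤ length b := le_max_left _ _
  have hl0 : l ≤ length b := (hmin' 0).trans hlen
  have h1 := one_lt_one_add_sqrt_two
  have hlen0 : 0 < length b := hl.trans_le hl0
  -- `norm_growth` loses three steps; the factor `(1 + √2) ^ 3` pays for them and covers `n < 3`.
  rcases le_or_gt 3 n with h3 | h3
  · obtain ⟨k, rfl⟩ := Nat.exists_eq_add_of_le' h3
    have key := norm_growth k (fun m => next^[m] b 0) (proper_sub_round_smul _ _)
      (fun m => by
        simp only [Function.iterate_succ_apply', next_zero, translate_one, next_one]) hn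
    have h4 : (1 + √2) ^ k * l ≤ 2 * length b :=
      calc (1 + √2) ^ k * l ≤ (1 + √2) ^ k * ‖next^[k + 2] b 0‖ := by
            gcongr
            exact hmin' _
        _ ≤ 2 * ‖b 0‖ := key
        _ ≤ 2 * length b := by gcongr
    calc (1 + √2) ^ (k + 3) * l = (1 + √2) ^ 3 * ((1 + √2) ^ k * l) := by ring
      _ ≤ (1 + √2) ^ 3 * (2 * length b) := by gcongr
      _ = 2 * (1 + √2) ^ 3 * length b := by ring
  · have h4 : (1 + √2) ^ n ≤ (1 + √2) ^ 3 := pow_le_pow_right₀ h1.le h3.le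
    calc (1 + √2) ^ n * l ≤ (1 + √2) ^ 3 * length b := by gcongr
      _ ≤ 2 * (1 + √2) ^ 3 * length b := by
        have : 0 < (1 + √2) ^ 3 * length b := by positivity
        linarith

theorem exists_run_le_logb {b : Fin 2 → Plane} {M l : ℝ} (hb : LinearIndependent ℝ b) (hl : 0 < l)
    (hmin : ∀ v ∈ Submodule.span ℤ (Set.range b), v ≠ 0 → l ≤ ‖v‖) (hM : length b < M) :
    ∃ (k : ℕ) (r : Fin 2 → Plane), Run b k r ∧
      (k : ℝ) ≤ Real.logb (1 + √2) (M / ((2 * (1 + √2) ^ 3)⁻¹ * l)) := by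
  have h1 := one_lt_one_add_sqrt_two
  have hex : ∃ n, ‖next^[n] b 0‖ ≤ ‖next^[n + 1] b 0‖ := by
    by_contra! hcon
    -- Termination follows from the same bound: endless decrease would contradict it for large `n`.
    obtain ⟨n, hn⟩ := pow_unbounded_of_one_lt (2 * (1 + √2) ^ 3 * length b / l) h1
    rw [div_lt_iff₀ hl] at hn
    exact hn.not_ge (pow_mul_le_of_steps hb hl hmin n fun m _ => hcon m)
  classical
  have hlt : ∀ m < Nat.find hex, ‖next^[m + 1] b 0‖ < ‖next^[m] b 0‖ :=
    fun m hm => not_le.1 (Nat.find_min hex hm)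
  obtain ⟨r, hr⟩ := exists_run _ b hlt (Nat.find_spec hex)
  refine ⟨_, r, hr, ?_⟩
  have hpow := pow_mul_le_of_steps hb hl hmin _ hlt
  have hlen : 0 ≤ length b := (norm_nonneg _).trans (le_max_left _ _)
  have hM0 : 0 < M := hlen.trans_lt hM
  rw [Real.le_logb_iff_rpow_le h1 (by positivity), Real.rpow_natCast, le_div_iff₀ (by positivity),
    mul_left_comm, inv_mul_le_iff₀ (by positivity)]
  exact hpow.trans (by gcongr)

theorem one_le_norm_of_mem_span {b : Fin 2 → Plane} (hb : ∀ i j, ∃ z : ℤ, b i j = (z : ℝ))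
    (v : Plane) (hv : v ∈ Submodule.span ℤ (Set.range b)) (hv0 : v ≠ 0) : 1 ≤ ‖v‖ := by
  have hint : ∀ j, ∃ z : ℤ, v j = (z : ℝ) := by
    clear hv0
    induction hv using Submodule.span_induction with
    | mem x hx =>
      obtain ⟨i, rfl⟩ := hx
      exact hb i
    | zero => exact fun j => ⟨0, by simp⟩
    | add x y _ _ hx hy =>
      intro j
      obtain ⟨m, hm⟩ := hx j
      obtain ⟨n, hn⟩ := hy j
      exact ⟨m + n, by simp [hm, hn]⟩
    | smul a x _ hx =>
      intro j
      obtain ⟨m, hm⟩ := hx j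
      exact ⟨a * m, by simp [hm]⟩
  obtain ⟨j, hj⟩ : ∃ j, v j ≠ 0 := by
    by_contra! h
    exact hv0 (by ext j; simpa using h j)
  obtain ⟨z, hz⟩ := hint j
  have hz0 : z ≠ 0 := by
    rintro rfl
    exact hj (by simpa using hz)
  calc (1 : ℝ) ≤ |(z : ℝ)| := by exact_mod_cast Int.one_le_abs hz0
    _ = ‖v j‖ := by rw [hz, Real.norm_eq_abs]
    _ ≤ ‖v‖ := PiLp.norm_apply_le v j

end GaussianAlgorithm

theorem mainTheorem2 :
    ∃ A : ℝ, 0 < A ∧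
      -- integral inputs
      (∀ (b : Fin 2 → Plane) (M : ℝ), LinearIndependent ℝ b →
        (∀ i j, ∃ z : ℤ, b i j = (z : ℝ)) →
        GaussianAlgorithm.length b < M →
        ∃ (k : ℕ) (r : Fin 2 → Plane), GaussianAlgorithm.Run b k r ∧
          (k : ℝ) ≤ Real.logb (1 + √2) (M / A)) ∧
      -- arbitrary real inputs, `l` being any lower bound for the nonzero lattice vectors
      (∀ (b : Fin 2 → Plane) (M l : ℝ), LinearIndependent ℝ b → 0 < l →
        (∀ v ∈ Submodule.span ℤ (Set.range b), v ≠ 0 → l ≤ ‖v‖) →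
        GaussianAlgorithm.length b < M →
        ∃ (k : ℕ) (r : Fin 2 → Plane), GaussianAlgorithm.Run b k r ∧
          (k : ℝ) ≤ Real.logb (1 + √2) (M / (A * l))) := by
  refine ⟨(2 * (1 + √2) ^ 3)⁻¹, by positivity, fun b M hb hint hM => ?_,
    fun b M l hb hl hmin hM => GaussianAlgorithm.exists_run_le_logb hb hl hmin hM⟩
  simpa only [mul_one] using GaussianAlgorithm.exists_run_le_logb hb one_pos
    (GaussianAlgorithm.one_le_norm_of_mem_span hint) hM
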